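/- Let $\Omega$ be an infinite set, let $\Omega^\Omega$ be the semigroup of all mappings $\Omega\to\Omega$ under composition, and let $\operatorname{Sym}(\Omega)\subseteq\Omega^\Omega$ be the symmetric group. A subsemigroup $T$ of a semigroup $S$ is called maximal if $T\neq S$ and, for every $s\in S\setminus T$, the subsemigroup generated by $T\cup\{s\}$ is $S$. For $f\in\Omega^\Omega$ let $$d(f)=|\Omega\setminus \Omega f|,\qquad c(f)=|\Omega\setminus\Gamma|,\qquad k(f,\mu)=|\{\alpha\in\Omega : |\alpha f^{-1}|\geq\mu\}|,$$ where $\Omega f$ is the image of $f$, $\Gamma\subseteq\Omega$ is any transversal of $f$ (that is, $f|_\Gamma$ is injective and $\Gamma f=\Omega f$; the cardinal $c(f)$ does not depend on $\Gamma$), $\alpha f^{-1}$ is the preimage of $\alpha$ under $f$, and $\mu\leq|\Omega|$ is a cardinal. Put \begin{align*} S_1&=\{f\in\Omega^\Omega : c(f)=0\text{ or }d(f)>0\},\\ S_2&=\{f\in\Omega^\Omega : c(f)>0\text{ or }d(f)=0\},\\ S_3(\mu)&=\{f\in\Omega^\Omega : c(f)<\mu\text{ or }d(f)\geq\mu\},\\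 S_4(\mu)&=\{f\in\Omega^\Omega : c(f)\geq\mu\text{ or }d(f)<\mu\},\\ S_5&=\{f\in\Omega^\Omega : k(f,|\Omega|)<|\Omega|\},\\ S_5'&=\{f\in\Omega^\Omega : \text{there is a cardinal }\nu<|\Omega|\text{ with }k(f,\nu)<|\Omega|\}. \end{align*} If $|\Omega|$ is a regular cardinal, then the maximal subsemigroups of $\Omega^\Omega$ containing $\operatorname{Sym}(\Omega)$ are exactly $S_1$, $S_2$, $S_3(\mu)$ and $S_4(\mu)$ for $\mu$ any infinite cardinal with $\mu\leq|\Omega|$, and $S_5$. If $|\Omega|$ is a singular cardinal, then they are exactly $S_1$, $S_2$, $S_3(\mu)$ and $S_4(\mu)$ for $\mu$ any infinite cardinal with $\mu\leq|\Omega|$, and $S_5'$. -/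

import Mathlib

open Cardinal

namespace FullTransformation

universe u

/-- A subset `T` of a semigroup `S` is a maximal subsemigroup if it is (the carrier of) a
subsemigroup, `T ≠ S`, and `T` together with any element outside `T` generates `S`. -/
def IsMaximalSubsemigroup {S : Type u} [Semigroup S] (T : Set S) : Prop :=
  ∃ M : Subsemigroup S, (M : Set S) = T ∧ M ≠ ⊤ ∧
    ∀ s : S, s ∉ M → Subsemigroup.closure (insert s (M : Set S)) = ⊤

variable {Ω : Type u}

/-- The symmetric group on `Ω`, as a subset of the semigroup of all mappings `Ω → Ω`. -/
def symSet (Ω : Type u) : Set (Function.End Ω) :=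
  {f | Function.Bijective (f : Ω → Ω)}

/-- `Γ` is a transversal of `f`: `f` is injective on `Γ`, and `Γ` has the same image as `Ω`. -/
def IsTransversal (f : Ω → Ω) (Γ : Set Ω) : Prop :=
  Set.InjOn f Γ ∧ f '' Γ = Set.range f

theorem exists_isTransversal (f : Ω → Ω) : ∃ Γ : Set Ω, IsTransversal f Γ := by
  obtain ⟨Γ, -, h1, h2⟩ := Set.SurjOn.exists_subset_injOn_image_eq
    (f := f) (s := Set.univ) (t := Set.range f) (by simp [Set.SurjOn])
  exact ⟨Γ, h1, h2⟩

/-- The defect `d(f)`: the number of points outside the image of `f`. -/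
noncomputable def defect (f : Ω → Ω) : Cardinal.{u} :=
  #((Set.range f)ᶜ : Set Ω)

/-- The collapse `c(f)`: the number of points outside a transversal of `f`.
It does not depend on the transversal, see `IsTransversal.mk_compl`. -/
noncomputable def collapse (f : Ω → Ω) : Cardinal.{u} :=
  #((exists_isTransversal f).chooseᶜ : Set Ω)

theorem IsTransversal.mk_compl_le {f : Ω → Ω} {Γ Δ : Set Ω} (hΓ : IsTransversal f Γ)
    (hΔ : IsTransversal f Δ) : #(Γᶜ : Set Ω) ≤ #(Δᶜ : Set Ω) := by
  classical
  have hg : ∀ x, ∃ y ∈ Γ, f y = f x := fun x => by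
    have : f x ∈ f '' Γ := by rw [hΓ.2]; exact ⟨x, rfl⟩
    exact this
  have hd : ∀ x, ∃ y ∈ Δ, f y = f x := fun x => by
    have : f x ∈ f '' Δ := by rw [hΔ.2]; exact ⟨x, rfl⟩
    exact this
  choose g hgΓ hgf using hg
  choose d hdΔ hdf using hd
  have gc : ∀ x y, f x = f y → g x = g y := fun x y h =>
    hΓ.1 (hgΓ x) (hgΓ y) (by rw [hgf, hgf, h])
  have dc : ∀ x y, f x = f y → d x = d y := fun x y h =>
    hΔ.1 (hdΔ x) (hdΔ y) (by rw [hdf, hdf, h])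
  have hf : ∀ x, f (Equiv.swap (g x) (d x) x) = f x := fun x => by
    rw [Equiv.swap_apply_def]
    split_ifs with h1 h2
    · exact hdf x
    · exact hgf x
    · rfl
  have key : ∀ x ∈ Γᶜ, Equiv.swap (g x) (d x) x ∈ Δᶜ := fun x hx hmem => by
    have h : Equiv.swap (g x) (d x) x = d x :=
      hΔ.1 hmem (hdΔ x) (by rw [hf, hdf])
    have h' : x = g x := (Equiv.swap (g x) (d x)).injective (by rw [h, Equiv.swap_apply_left])
    exact hx (h' ▸ hgΓ x)
  refine Cardinal.mk_le_of_injective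
    (f := fun x : (Γᶜ : Set Ω) => (⟨_, key x.1 x.2⟩ : (Δᶜ : Set Ω))) ?_
  rintro ⟨x, hx⟩ ⟨y, hy⟩ h
  have h : Equiv.swap (g x) (d x) x = Equiv.swap (g y) (d y) y := congrArg Subtype.val h
  have hxy : f x = f y := by rw [← hf x, ← hf y, h]
  rw [gc x y hxy, dc x y hxy] at h
  exact Subtype.ext ((Equiv.swap (g y) (d y)).injective h)

theorem IsTransversal.mk_compl {f : Ω → Ω} {Γ : Set Ω} (hΓ : IsTransversal f Γ) :
    #(Γᶜ : Set Ω) = collapse f :=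
  le_antisymm (hΓ.mk_compl_le (exists_isTransversal f).choose_spec)
    ((exists_isTransversal f).choose_spec.mk_compl_le hΓ)

/-- `k(f, μ)`: the number of points whose preimage under `f` has at least `μ` elements. -/
noncomputable def contraction (f : Ω → Ω) (μ : Cardinal.{u}) : Cardinal.{u} :=
  #{α : Ω | μ ≤ #(f ⁻¹' {α} : Set Ω)}

/-- The set `S₁`. -/
def S1 (Ω : Type u) : Set (Function.End Ω) :=
  {f | collapse f = 0 ∨ 0 < defect f}

/-- The set `S₂`. -/
def S2 (Ω : Type u) : Set (Function.End Ω) :=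
  {f | 0 < collapse f ∨ defect f = 0}

/-- The set `S₃(μ)`. -/
def S3 (Ω : Type u) (μ : Cardinal.{u}) : Set (Function.End Ω) :=
  {f | collapse f < μ ∨ μ ≤ defect f}

/-- The set `S₄(μ)`. -/
def S4 (Ω : Type u) (μ : Cardinal.{u}) : Set (Function.End Ω) :=
  {f | μ ≤ collapse f ∨ defect f < μ}

/-- The set `S₅`. -/
def S5 (Ω : Type u) : Set (Function.End Ω) :=
  {f | contraction f #Ω < #Ω}

/-- The set `S₅′`. -/
def S5' (Ω : Type u) : Set (Function.End Ω) :=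
  {f | ∃ ν : Cardinal.{u}, ν < #Ω ∧ contraction f ν < #Ω}

end FullTransformation

open FullTransformation

/-! The listed sets form an antichain of proper subsemigroups containing the symmetric group, and a
subsemigroup `U` that contains the symmetric group but lies in none of them is everything; by
`isMaximalSubsemigroup_iff_mem` this determines the maximal ones.

Generation rests on products `f ∘ π ∘ g` with `π` a permutation. Since `U` escapes `S2` and every
`S4 Ω μ`, it has an element of full defect whose collapse can be lowered step by step to zero: an
injection `i` with defect `#Ω`. Dually, escaping `S1` and every `S3 Ω μ` gives a surjection `s` with
collapse `#Ω`. Escaping `S5` or `S5'` gives an element with `#Ω` many fibres of size `#Ω`, directly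
in the regular case and by `exists_mem_contraction_of_isSingular` in the singular case. Composing
with `s` makes every fibre that large, giving `w`. Any map is then `w ∘ π ∘ i`: pick distinct points
in the prescribed fibres of `w` and let `π` carry the image of `i` to them.

The antichain property comes from maps with prescribed collapse and defect and fibres of size at
most 2, together with one map having many full fibres. -/

namespace FullTransformation

universe u

/-! ### Maximal subsemigroups from a covering antichain. -/

section Semigroup

variable {S : Type u} [Semigroup S]

/-- The maximal subsemigroups containing `C` are the members of an antichain of proper
subsemigroups containing `C` such that every proper subsemigroup containing `C` lies below a member
of the antichain. -/
theorem isMaximalSubsemigroup_iff_mem {𝓛 : Set (Set S)} {C : Set S}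
    (hmul : ∀ L ∈ 𝓛, ∀ f ∈ L, ∀ g ∈ L, f * g ∈ L) (hC : ∀ L ∈ 𝓛, C ⊆ L)
    (hproper : ∀ L ∈ 𝓛, L ≠ Set.univ) (hanti : ∀ L ∈ 𝓛, ∀ L' ∈ 𝓛, L ⊆ L' → L = L')
    (hcover : ∀ U : Subsemigroup S, C ⊆ U → (∀ L ∈ 𝓛, ¬ (U : Set S) ⊆ L) → U = ⊤)
    (T : Set S) : (IsMaximalSubsemigroup T ∧ C ⊆ T) ↔ T ∈ 𝓛 := by
  constructor
  · rintro ⟨⟨M, rfl, hM, hmax⟩, hCM⟩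
    obtain ⟨L, hL, hML⟩ : ∃ L ∈ 𝓛, (M : Set S) ⊆ L := by
      by_contra! h
      exact hM (hcover M hCM h)
    obtain rfl | ⟨s, hs, hsM⟩ := hML.eq_or_ssubset.imp id Set.exists_of_ssubset
    · exact hL
    · let N : Subsemigroup S := ⟨L, fun ha hb => hmul L hL _ ha _ hb⟩
      have hN : N = ⊤ := by
        rw [eq_top_iff, ← hmax s hsM, Subsemigroup.closure_le]
        exact Set.insert_subset hs hML
      exact absurd (congrArg (fun N : Subsemigroup S => (N : Set S)) hN) (hproper L hL)
  · intro hT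
    refine ⟨⟨⟨T, fun ha hb => hmul T hT _ ha _ hb⟩, rfl, fun h => hproper T hT
      (congrArg (fun N : Subsemigroup S => (N : Set S)) h), fun s hs => ?_⟩, hC T hT⟩
    have hsub : insert s T ⊆ (Subsemigroup.closure (insert s T) : Set S) :=
      Subsemigroup.subset_closure
    refine hcover _ (((hC T hT).trans (Set.subset_insert s T)).trans hsub) fun L hL h => hs ?_
    have := hanti T hT L hL ((Set.subset_insert s T).trans (hsub.trans h))
    subst this
    exact h (hsub (Set.mem_insert s T))

end Semigroup

/-! ### Collapse, defect and contraction of a composite. -/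

variable {Ω : Type u}

/-- A set on which `f` is injective extends to a transversal. Every later upper bound on a collapse
comes from exhibiting such a set. -/
theorem collapse_le_of_injOn {f : Ω → Ω} {A : Set Ω} (h : Set.InjOn f A) :
    collapse f ≤ #(Aᶜ : Set Ω) := by
  obtain ⟨Γ, hA, -, hΓ⟩ := h.bijOn_image.exists_extend_of_subset (Set.subset_univ A)
    (Set.image_subset_range f A) (by simp [Set.SurjOn])
  have hT : IsTransversal f Γ := ⟨hΓ.injOn, hΓ.image_eq⟩
  rw [← hT.mk_compl]
  exact mk_le_mk_of_subset (Set.compl_subset_compl.2 hA)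

theorem exists_isTransversal_mk_compl (f : Ω → Ω) :
    ∃ Γ : Set Ω, IsTransversal f Γ ∧ #(Γᶜ : Set Ω) = collapse f :=
  let ⟨Γ, h⟩ := exists_isTransversal f
  ⟨Γ, h, h.mk_compl⟩

theorem collapse_eq_zero_iff {f : Ω → Ω} : collapse f = 0 ↔ Function.Injective f := by
  constructor
  · intro h
    obtain ⟨Γ, hΓ, hc⟩ := exists_isTransversal_mk_compl f
    rw [h, mk_set_eq_zero_iff, Set.compl_empty_iff] at hc
    subst hc
    exact Set.injOn_univ.1 hΓ.1
  · intro h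
    simpa using collapse_le_of_injOn (h.injOn (s := Set.univ))

theorem defect_eq_zero_iff {f : Ω → Ω} : defect f = 0 ↔ Function.Surjective f := by
  rw [defect, mk_set_eq_zero_iff, Set.compl_empty_iff, Set.range_eq_univ]

theorem collapse_le_mk (f : Ω → Ω) : collapse f ≤ #Ω := mk_set_le _

theorem defect_le_mk (f : Ω → Ω) : defect f ≤ #Ω := mk_set_le _

theorem collapse_le_collapse_comp (f g : Ω → Ω) : collapse g ≤ collapse (f ∘ g) := by
  obtain ⟨Γ, hΓ, hc⟩ := exists_isTransversal_mk_compl (f ∘ g)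
  rw [← hc]
  exact collapse_le_of_injOn fun x hx y hy h => hΓ.1 hx hy (congrArg f h)

theorem defect_le_defect_comp (f g : Ω → Ω) : defect f ≤ defect (f ∘ g) :=
  mk_le_mk_of_subset (Set.compl_subset_compl.2 (Set.range_comp_subset_range g f))

theorem collapse_comp_le (f g : Ω → Ω) : collapse (f ∘ g) ≤ collapse f + collapse g := by
  obtain ⟨A, hA, hAc⟩ := exists_isTransversal_mk_compl f
  obtain ⟨B, hB, hBc⟩ := exists_isTransversal_mk_compl g
  have h : Set.InjOn (f ∘ g) (B ∩ g ⁻¹' A) := fun x hx y hy hxy =>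
    hB.1 hx.1 hy.1 (hA.1 hx.2 hy.2 hxy)
  have hsub : (B ∩ g ⁻¹' A)ᶜ ⊆ (B ∩ g ⁻¹' Aᶜ) ∪ Bᶜ := by
    intro x hx
    by_cases hxB : x ∈ B
    · exact Or.inl ⟨hxB, fun hxA => hx ⟨hxB, hxA⟩⟩
    · exact Or.inr hxB
  refine (collapse_le_of_injOn h).trans ((mk_le_mk_of_subset hsub).trans
    ((mk_union_le _ _).trans ?_))
  rw [← hAc, ← hBc]
  gcongr
  rw [← mk_image_eq_of_injOn g _ (hB.1.mono Set.inter_subset_left)]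
  refine mk_le_mk_of_subset ?_
  rintro _ ⟨x, hx, rfl⟩
  exact hx.2

theorem defect_comp_le (f g : Ω → Ω) : defect (f ∘ g) ≤ defect f + defect g := by
  have hsub : (Set.range (f ∘ g))ᶜ ⊆ (Set.range f)ᶜ ∪ f '' (Set.range g)ᶜ := by
    intro x hx
    by_cases hxf : x ∈ Set.range f
    · obtain ⟨y, rfl⟩ := hxf
      exact Or.inr ⟨y, fun ⟨z, hz⟩ => hx ⟨z, by simp [hz]⟩, rfl⟩
    · exact Or.inl hxf
  refine (mk_le_mk_of_subset hsub).trans ((mk_union_le _ _).trans ?_)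
  rw [defect, defect]
  gcongr
  exact mk_image_le

/-- A point of `Γ` missed by `g` can have its value hit by `f ∘ g` only through a point outside `Γ`,
because `f` is injective on `Γ`. Such values lie in `f '' Γᶜ`; this and `Γᶜ` itself account for the
two copies of `collapse f`. -/
theorem defect_right_le (f g : Ω → Ω) :
    defect g ≤ defect (f ∘ g) + (collapse f + collapse f) := by
  obtain ⟨Γ, hΓ, hc⟩ := exists_isTransversal_mk_compl f
  have hsub : (Set.range g)ᶜ ⊆
      {x ∈ Γ | f x ∉ Set.range (f ∘ g)} ∪ ({x ∈ Γ | f x ∈ f '' Γᶜ} ∪ Γᶜ) := by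
    intro x hx
    by_cases hxΓ : x ∈ Γ
    · by_cases hfx : f x ∈ Set.range (f ∘ g)
      · obtain ⟨y, hy⟩ := hfx
        refine Or.inr (Or.inl ⟨hxΓ, g y, fun hgy => hx ⟨y, hΓ.1 hgy hxΓ hy⟩, hy⟩)
      · exact Or.inl ⟨hxΓ, hfx⟩
    · exact Or.inr (Or.inr hxΓ)
  refine (mk_le_mk_of_subset hsub).trans ((mk_union_le _ _).trans ?_)
  refine add_le_add ?_ ((mk_union_le _ _).trans (add_le_add ?_ hc.le))
  · rw [← mk_image_eq_of_injOn f _ (hΓ.1.mono (Set.sep_subset _ _))]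
    refine mk_le_mk_of_subset ?_
    rintro _ ⟨x, hx, rfl⟩
    exact hx.2
  · rw [← mk_image_eq_of_injOn f _ (hΓ.1.mono (Set.sep_subset _ _)), ← hc]
    refine le_trans (mk_le_mk_of_subset ?_) (mk_image_le (f := f))
    rintro _ ⟨x, hx, rfl⟩
    exact hx.2

/-- If `Γ` is a transversal of `f ∘ g`, then `f` is injective on `g '' Γ`, and a point outside that
set is missed by `g` or comes from `Γᶜ`. -/
theorem collapse_left_le (f g : Ω → Ω) : collapse f ≤ defect g + collapse (f ∘ g) := by
  obtain ⟨Γ, hΓ, hc⟩ := exists_isTransversal_mk_compl (f ∘ g)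
  have h : Set.InjOn f (g '' Γ) := by
    rintro _ ⟨x, hx, rfl⟩ _ ⟨y, hy, rfl⟩ hxy
    rw [hΓ.1 hx hy hxy]
  have hsub : (g '' Γ)ᶜ ⊆ (Set.range g)ᶜ ∪ g '' Γᶜ := by
    intro x hx
    by_cases hxg : x ∈ Set.range g
    · obtain ⟨y, rfl⟩ := hxg
      exact Or.inr ⟨y, fun hy => hx ⟨y, hy, rfl⟩, rfl⟩
    · exact Or.inl hxg
  refine (collapse_le_of_injOn h).trans ((mk_le_mk_of_subset hsub).trans
    ((mk_union_le _ _).trans (add_le_add le_rfl ?_)))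
  rw [← hc]
  exact mk_image_le

theorem contraction_anti (f : Ω → Ω) {μ ν : Cardinal.{u}} (h : μ ≤ ν) :
    contraction f ν ≤ contraction f μ :=
  mk_le_mk_of_subset fun _ hα => h.trans hα

theorem contraction_le_mk (f : Ω → Ω) (μ : Cardinal.{u}) : contraction f μ ≤ #Ω := mk_set_le _

/-- A point with a large preimage under `f ∘ g` has a large preimage under `f` or is the image
under `f` of a point with a large preimage under `g`. -/
theorem contraction_comp_le (f g : Ω → Ω) {μ ν : Cardinal.{u}}
    (h : ∀ (ι : Type u) (c : ι → Cardinal.{u}), #ι < ν → (∀ i, c i < ν) → Cardinal.sum c < μ) :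
    contraction (f ∘ g) μ ≤ contraction f ν + contraction g ν := by
  have hsub : {α : Ω | μ ≤ #((f ∘ g) ⁻¹' {α} : Set Ω)} ⊆
      {α : Ω | ν ≤ #(f ⁻¹' {α} : Set Ω)} ∪ f '' {α : Ω | ν ≤ #(g ⁻¹' {α} : Set Ω)} := by
    intro α hα
    by_contra hcon
    simp only [Set.mem_union, Set.mem_ofPred_eq, Set.mem_image, not_or, not_le, not_exists,
      not_and] at hcon
    have hα' : μ ≤ #((f ∘ g) ⁻¹' {α} : Set Ω) := hα
    refine absurd hα' (not_le.2 ?_)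
    have he : (f ∘ g) ⁻¹' {α} = ⋃ i : (f ⁻¹' {α} : Set Ω), g ⁻¹' {(i : Ω)} := by
      ext x
      simp
    rw [he]
    refine mk_iUnion_le_sum_mk.trans_lt (h _ _ hcon.1 fun i => ?_)
    by_contra hi
    exact hcon.2 i (not_lt.1 hi) i.2
  exact (mk_le_mk_of_subset hsub).trans ((mk_union_le _ _).trans (add_le_add le_rfl mk_image_le))

/-! ### Closure of the listed sets under composition. -/

theorem mem_S1_iff {f : Ω → Ω} :
    f ∈ S1 Ω ↔ Function.Injective f ∨ ¬ Function.Surjective f :=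
  or_congr collapse_eq_zero_iff (pos_iff_ne_zero.trans defect_eq_zero_iff.not)

theorem mem_S2_iff {f : Ω → Ω} :
    f ∈ S2 Ω ↔ ¬ Function.Injective f ∨ Function.Surjective f :=
  or_congr (pos_iff_ne_zero.trans collapse_eq_zero_iff.not) defect_eq_zero_iff

section Closed

variable {f g : Function.End Ω}

theorem S1.mul_mem (hf : f ∈ S1 Ω) (hg : g ∈ S1 Ω) : f * g ∈ S1 Ω := by
  refine mem_S1_iff.2 (?_ : Function.Injective (f ∘ g) ∨ ¬ Function.Surjective (f ∘ g))
  by_contra! h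
  have hfi := (mem_S1_iff.1 hf).resolve_right (not_not.2 h.2.of_comp)
  have hgi := (mem_S1_iff.1 hg).resolve_right (not_not.2 (h.2.of_comp_left hfi))
  exact h.1 (hfi.comp hgi)

theorem S2.mul_mem (hf : f ∈ S2 Ω) (hg : g ∈ S2 Ω) : f * g ∈ S2 Ω := by
  refine mem_S2_iff.2 (?_ : ¬ Function.Injective (f ∘ g) ∨ Function.Surjective (f ∘ g))
  by_contra! h
  have hgs := (mem_S2_iff.1 hg).resolve_left (not_not.2 h.1.of_comp)
  have hfs := (mem_S2_iff.1 hf).resolve_left (not_not.2 (h.1.of_comp_right hgs))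
  exact h.2 (hfs.comp hgs)

/-- Smallness below `μ` passes from the defect of the product to the defect and then the collapse of
`f`, then to the defect and the collapse of `g`. Sums stay below `μ` because `μ` is infinite. For
`S4` the chain runs from `g` to `f`. -/
theorem S3.mul_mem {μ : Cardinal.{u}} (hμ : ℵ₀ ≤ μ) (hf : f ∈ S3 Ω μ) (hg : g ∈ S3 Ω μ) :
    f * g ∈ S3 Ω μ := by
  change collapse (f ∘ g) < μ ∨ μ ≤ defect (f ∘ g)
  refine or_iff_not_imp_right.2 fun hd => ?_
  rw [not_le] at hd
  have hcf : collapse f < μ :=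
    hf.resolve_right (not_le.2 ((defect_le_defect_comp f g).trans_lt hd))
  have hdg : defect g < μ :=
    (defect_right_le f g).trans_lt (add_lt_of_lt hμ hd (add_lt_of_lt hμ hcf hcf))
  exact (collapse_comp_le f g).trans_lt (add_lt_of_lt hμ hcf (hg.resolve_right (not_le.2 hdg)))

theorem S4.mul_mem {μ : Cardinal.{u}} (hμ : ℵ₀ ≤ μ) (hf : f ∈ S4 Ω μ) (hg : g ∈ S4 Ω μ) :
    f * g ∈ S4 Ω μ := by
  change μ ≤ collapse (f ∘ g) ∨ defect (f ∘ g) < μ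
  refine or_iff_not_imp_left.2 fun hc => ?_
  rw [not_le] at hc
  have hdg : defect g < μ :=
    hg.resolve_left (not_le.2 ((collapse_le_collapse_comp f g).trans_lt hc))
  have hcf : collapse f < μ := (collapse_left_le f g).trans_lt (add_lt_of_lt hμ hdg hc)
  exact (defect_comp_le f g).trans_lt (add_lt_of_lt hμ (hf.resolve_left (not_le.2 hcf)) hdg)

theorem S5.mul_mem (hΩ : (#Ω).IsRegular) (hf : f ∈ S5 Ω) (hg : g ∈ S5 Ω) : f * g ∈ S5 Ω :=
  (contraction_comp_le f g fun _ _ => sum_lt_of_isRegular hΩ).trans_lt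
    (add_lt_of_lt hΩ.aleph0_le hf hg)

theorem S5'.mul_mem (hΩ : (#Ω).IsSingular) (hf : f ∈ S5' Ω) (hg : g ∈ S5' Ω) :
    f * g ∈ S5' Ω := by
  obtain ⟨μ, hμ, hf⟩ := hf
  obtain ⟨ν, hν, hg⟩ := hg
  have hω : ℵ₀ < #Ω := hΩ.aleph0_le.lt_of_ne fun h => not_isSingular_aleph0 (h ▸ hΩ)
  -- An infinite common bound satisfies `τ * τ = τ`, so fewer than `τ` fibres of size below `τ` have
  -- union of size at most `τ`. The successor makes this strict, and it is still below `#Ω` because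
  -- a singular cardinal is a limit.
  set τ := max ℵ₀ (max μ ν)
  have hτ : τ < #Ω := max_lt hω (max_lt hμ hν)
  have hτω : ℵ₀ ≤ τ := le_max_left _ _
  refine ⟨Order.succ τ, hΩ.isSuccLimit.succ_lt hτ, ?_⟩
  refine (contraction_comp_le (ν := τ) f g fun ι c hι hc => ?_).trans_lt
    (add_lt_of_lt hΩ.aleph0_le ((contraction_anti f ?_).trans_lt hf)
      ((contraction_anti g ?_).trans_lt hg))
  · rw [Order.lt_succ_iff]
    refine (sum_le_sum c (fun _ => τ) fun i => (hc i).le).trans ?_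
    rw [sum_const']
    exact mul_le_of_le hτω hι.le le_rfl
  · exact (le_max_left _ _).trans (le_max_right _ _)
  · exact (le_max_right _ _).trans (le_max_right _ _)

end Closed

/-! ### Extending partial injections to permutations, and distinct representatives. -/

theorem exists_perm_extending {X : Type u} {i j : X → Ω} (hi : Function.Injective i)
    (hj : Function.Injective j)
    (h : #((Set.range i)ᶜ : Set Ω) = #((Set.range j)ᶜ : Set Ω)) :
    ∃ π : Equiv.Perm Ω, ∀ x, π (i x) = j x := by
  classical
  obtain ⟨e⟩ := Cardinal.eq.1 h
  refine ⟨(Equiv.Set.sumCompl (Set.range i)).symm.trans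
    ((Equiv.sumCongr ((Equiv.ofInjective i hi).symm.trans (Equiv.ofInjective j hj)) e).trans
      (Equiv.Set.sumCompl (Set.range j))), fun x => ?_⟩
  have : (Equiv.ofInjective i hi).symm ⟨i x, Set.mem_range_self x⟩ = x :=
    Equiv.ofInjective_symm_apply hi x
  simp [Equiv.Set.sumCompl_symm_apply_of_mem, this]

theorem exists_perm_extending_of_lt [Infinite Ω] {X : Type u} {i j : X → Ω}
    (hi : Function.Injective i) (hj : Function.Injective j) (h : #X < #Ω) :
    ∃ π : Equiv.Perm Ω, ∀ x, π (i x) = j x := by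
  refine exists_perm_extending hi hj ?_
  rw [mk_compl_of_infinite _ (by rwa [mk_range_eq _ hi]),
    mk_compl_of_infinite _ (by rwa [mk_range_eq _ hj])]

/-- A family of sets, none of which has fewer elements than the index set, has a system of
distinct representatives. -/
theorem exists_injective_forall_mem {X : Type u} (B : X → Set Ω) (h : ∀ x, #X ≤ #(B x)) :
    ∃ j : X → Ω, Function.Injective j ∧ ∀ x, j x ∈ B x := by
  obtain ⟨r, wo, hr⟩ := exists_ord_eq X
  -- The well-order `r` has the least order type possible, so `x` has fewer than `#X` predecessors
  -- and their representatives cannot exhaust `B x`.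
  have key : ∀ (x : X) (g : ∀ y, r y x → Ω), ∃ b ∈ B x, ∀ y hy, g y hy ≠ b := by
    intro x g
    by_contra! hcon
    refine absurd (h x) (not_le.2 ?_)
    have hsub : B x ⊆ Set.range fun y : {y // r y x} => g y.1 y.2 := fun b hb =>
      let ⟨y, hy, e⟩ := hcon b hb
      ⟨⟨y, hy⟩, e⟩
    refine ((mk_le_mk_of_subset hsub).trans mk_range_le).trans_lt ?_
    exact card_typein_lt x hr
  choose F hF hne using key
  have wf : WellFounded r := IsWellFounded.wf
  have hfix : ∀ x, wf.fix F x = F x fun y _ => wf.fix F y := wf.fix_eq F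
  have hlt : ∀ x y, r x y → wf.fix F x ≠ wf.fix F y := fun x y hxy => by
    rw [hfix y]
    exact hne y (fun z _ => wf.fix F z) x hxy
  refine ⟨wf.fix F, fun x y hxy => ?_, fun x => by rw [hfix x]; exact hF _ _⟩
  rcases trichotomous_of r x y with h1 | h1 | h1
  · exact absurd hxy (hlt x y h1)
  · exact h1
  · exact absurd hxy.symm (hlt y x h1)

/-- Representatives are chosen for two copies of the family; those of the second copy are left over
and make the complement full. -/
theorem exists_injective_forall_mem_mk_compl [Infinite Ω] {X : Type u} (hX : #X = #Ω)
    (B : X → Set Ω) (h : ∀ x, #Ω ≤ #(B x)) :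
    ∃ j : X → Ω, Function.Injective j ∧ (∀ x, j x ∈ B x) ∧
      #((Set.range j)ᶜ : Set Ω) = #Ω := by
  have hXX : #(X ⊕ X) = #Ω := by
    rw [← add_def, hX, add_eq_self (aleph0_le_mk Ω)]
  obtain ⟨j, hj, hB⟩ := exists_injective_forall_mem (X := X ⊕ X) (Sum.elim B B) (by
    rw [hXX]
    rintro (x | x) <;> exact h x)
  refine ⟨j ∘ Sum.inl, hj.comp Sum.inl_injective, fun x => hB (Sum.inl x),
    le_antisymm (mk_set_le _) ?_⟩
  rw [← hX, ← mk_range_eq _ (hj.comp Sum.inr_injective)]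
  refine mk_le_mk_of_subset ?_
  rintro _ ⟨x, rfl⟩ ⟨y, hy⟩
  exact Sum.inl_ne_inr (hj hy)

/-! ### Generating the full semigroup. -/

section Generation

variable {U : Subsemigroup (Function.End Ω)}

theorem comp_mem {f g : Ω → Ω} (hf : f ∈ U) (hg : g ∈ U) : (f ∘ g : Ω → Ω) ∈ U :=
  U.mul_mem hf hg

theorem comp_perm_comp_mem (hU : symSet Ω ⊆ U) {f g : Ω → Ω} (hf : f ∈ U) (hg : g ∈ U)
    (π : Equiv.Perm Ω) : (f ∘ π ∘ g : Ω → Ω) ∈ U :=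
  comp_mem hf (comp_mem (hU π.bijective) hg)

theorem exists_mem_collapse_lt [Infinite Ω] (hU : symSet Ω ⊆ U) (h2 : ¬ (U : Set _) ⊆ S2 Ω)
    (h4 : ∀ μ, ℵ₀ ≤ μ → μ ≤ #Ω → ¬ (U : Set _) ⊆ S4 Ω μ) {u : Ω → Ω} (hu : u ∈ U)
    (hc : collapse u < #Ω) (hc0 : collapse u ≠ 0) :
    ∃ v : Ω → Ω, v ∈ U ∧ collapse v < collapse u ∧ defect u ≤ defect v := by
  obtain ⟨Γ, hΓ, hΓc⟩ := exists_isTransversal_mk_compl u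
  rcases le_or_gt ℵ₀ (collapse u) with hω | hω
  · obtain ⟨v, hv, hvS⟩ : ∃ v : Ω → Ω, v ∈ U ∧ v ∉ S4 Ω (collapse u) :=
      Set.not_subset.1 (h4 _ hω hc.le)
    obtain ⟨hcv, hdv⟩ : collapse v < collapse u ∧ collapse u ≤ defect v := by
      have hvS : ¬ (_ ∨ _) := hvS
      simpa using hvS
    rw [← hΓc] at hdv
    obtain ⟨e⟩ := hdv
    -- Points missed by `v` are moved onto all of `Γᶜ`, so `π ∘ v` lands in `Γ`, where `u` is
    -- injective, and `u ∘ π ∘ v` collapses no more than `v`.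
    obtain ⟨π, hπ⟩ := exists_perm_extending_of_lt (i := fun x => (e x : Ω))
      (j := fun x : (Γᶜ : Set Ω) => (x : Ω)) (Subtype.val_injective.comp e.injective)
      Subtype.val_injective (hΓc ▸ hc)
    have hmem : ∀ x, π (v x) ∈ Γ := by
      intro x
      by_contra hx
      have := hπ ⟨_, hx⟩
      exact (e ⟨_, hx⟩).2 ⟨x, (π.injective this).symm⟩
    refine ⟨_, comp_perm_comp_mem hU hu hv π, hcv.trans_le' ?_, defect_le_defect_comp _ _⟩
    obtain ⟨A, hA, hAc⟩ := exists_isTransversal_mk_compl v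
    rw [← hAc]
    exact collapse_le_of_injOn fun x hx y hy hxy =>
      hA.1 hx hy (π.injective (hΓ.1 (hmem x) (hmem y) hxy))
  · obtain ⟨v, hv, hvS⟩ : ∃ v : Ω → Ω, v ∈ U ∧ v ∉ S2 Ω :=
      Set.not_subset.1 h2
    obtain ⟨hvi, hvs⟩ := not_or.1 (mem_S2_iff.not.1 hvS)
    rw [not_not] at hvi
    simp only [Function.Surjective, not_forall] at hvs
    obtain ⟨q, hq⟩ := hvs
    rw [← hΓc, mk_ne_zero_iff] at hc0
    obtain ⟨p, hp⟩ := hc0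
    classical
    -- The missed point `q` goes to `p ∉ Γ`, so `π ∘ v` avoids `p`. As `v` is injective and `Γᶜ` is
    -- finite, avoiding one point of `Γᶜ` strictly lowers the collapse.
    let π := Equiv.swap q p
    refine ⟨_, comp_perm_comp_mem hU hu hv π, ?_, defect_le_defect_comp _ _⟩
    have hinj : Set.InjOn (u ∘ π ∘ v) ((π ∘ v) ⁻¹' Γ) := fun x hx y hy hxy =>
      hvi (π.injective (hΓ.1 hx hy hxy))
    refine (collapse_le_of_injOn hinj).trans_lt ?_
    have hfin : (Γᶜ : Set Ω).Finite := lt_aleph0_iff_set_finite.1 (hΓc ▸ hω)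
    have hle : #(((π ∘ v) ⁻¹' Γ)ᶜ : Set Ω) ≤ #(Γᶜ \ {p} : Set Ω) := by
      rw [← mk_image_eq (f := π ∘ v) (π.injective.comp hvi)]
      refine mk_le_mk_of_subset ?_
      rintro _ ⟨x, hx, rfl⟩
      refine ⟨hx, fun hxp => hq ⟨x, π.injective ?_⟩⟩
      rw [Set.mem_singleton_iff] at hxp
      rw [Function.comp_apply] at hxp
      rw [hxp, Equiv.swap_apply_left]
    refine hle.trans_lt ?_
    rw [← hΓc, ← mk_sdiff_add_mk (Set.singleton_subset_iff.2 hp), mk_singleton]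
    obtain ⟨n, hn⟩ := lt_aleph0.1 (lt_aleph0_iff_set_finite.2 (hfin.subset
      (Set.sdiff_subset (t := {p}))))
    rw [hn]
    exact_mod_cast n.lt_succ_self

/-- Dual to `exists_mem_collapse_lt`, with the new factor on the left: points missed by `u` are
moved to points that `v` does not need in order to attain its image. -/
theorem exists_mem_defect_lt [Infinite Ω] (hU : symSet Ω ⊆ U) (h1 : ¬ (U : Set _) ⊆ S1 Ω)
    (h3 : ∀ μ, ℵ₀ ≤ μ → μ ≤ #Ω → ¬ (U : Set _) ⊆ S3 Ω μ) {u : Ω → Ω} (hu : u ∈ U)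
    (hd : defect u < #Ω) (hd0 : defect u ≠ 0) :
    ∃ v : Ω → Ω, v ∈ U ∧ defect v < defect u ∧ collapse u ≤ collapse v := by
  rcases le_or_gt ℵ₀ (defect u) with hω | hω
  · obtain ⟨v, hv, hvS⟩ : ∃ v : Ω → Ω, v ∈ U ∧ v ∉ S3 Ω (defect u) :=
      Set.not_subset.1 (h3 _ hω hd.le)
    obtain ⟨hcv, hdv⟩ : defect u ≤ collapse v ∧ defect v < defect u := by
      have hvS : ¬ (_ ∨ _) := hvS
      simpa using hvS
    obtain ⟨Γ, hΓ, hΓc⟩ := exists_isTransversal_mk_compl v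
    rw [← hΓc, defect] at hcv
    obtain ⟨e⟩ := hcv
    obtain ⟨π, hπ⟩ := exists_perm_extending_of_lt (i := fun x : ((Set.range u)ᶜ : Set Ω) => (x : Ω))
      (j := fun x => (e x : Ω)) Subtype.val_injective (Subtype.val_injective.comp e.injective) hd
    refine ⟨_, comp_perm_comp_mem hU hv hu π, hdv.trans_le' ?_,
      collapse_le_collapse_comp (v ∘ π) u⟩
    refine mk_le_mk_of_subset (Set.compl_subset_compl.2 ?_)
    rw [← hΓ.2]
    rintro _ ⟨x, hx, rfl⟩
    by_contra hcon
    have hxu : π.symm x ∉ Set.range u := fun ⟨y, hy⟩ => hcon ⟨y, by simp [hy]⟩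
    have := hπ ⟨_, hxu⟩
    rw [Equiv.apply_symm_apply] at this
    exact (e ⟨_, hxu⟩).2 (this ▸ hx)
  · obtain ⟨v, hv, hvS⟩ : ∃ v : Ω → Ω, v ∈ U ∧ v ∉ S1 Ω :=
      Set.not_subset.1 h1
    obtain ⟨hvi, hvs⟩ := not_or.1 (mem_S1_iff.not.1 hvS)
    rw [not_not] at hvs
    simp only [Function.Injective, not_forall] at hvi
    obtain ⟨q, q', hqq, hne⟩ := hvi
    rw [defect, mk_ne_zero_iff] at hd0
    obtain ⟨p, hp⟩ := hd0
    classical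
    let π := Equiv.swap p q
    refine ⟨_, comp_perm_comp_mem hU hv hu π, ?_, collapse_le_collapse_comp (v ∘ π) u⟩
    have hfin : ((Set.range u)ᶜ : Set Ω).Finite := lt_aleph0_iff_set_finite.1 hω
    have hsub : (Set.range (v ∘ π ∘ u))ᶜ ⊆ (v ∘ π) '' ((Set.range u)ᶜ \ {p}) := by
      intro y hy
      -- Since `v q = v q'`, the point `q` is dispensable, so missing `p`, which `π` sends to `q`,
      -- costs nothing.
      obtain ⟨x, hx, hxq⟩ : ∃ x, v x = y ∧ x ≠ q := by
        obtain ⟨x, rfl⟩ := hvs y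
        by_cases hx : x = q
        · exact ⟨q', by rw [hx, hqq], fun h => hne h.symm⟩
        · exact ⟨x, rfl, hx⟩
      refine ⟨π.symm x, ⟨fun ⟨z, hz⟩ => hy ⟨z, by simp [hz, hx]⟩, fun hp' => hxq ?_⟩,
        by simp [hx]⟩
      rw [Set.mem_singleton_iff, Equiv.symm_apply_eq] at hp'
      simpa [π] using hp'
    refine ((mk_le_mk_of_subset hsub).trans mk_image_le).trans_lt ?_
    rw [defect, ← mk_sdiff_add_mk (Set.singleton_subset_iff.2 hp), mk_singleton]
    obtain ⟨n, hn⟩ := lt_aleph0.1 (lt_aleph0_iff_set_finite.2 (hfin.subset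
      (Set.sdiff_subset (t := {p}))))
    rw [hn]
    exact_mod_cast n.lt_succ_self

theorem exists_mem_injective_defect_eq [Infinite Ω] (hU : symSet Ω ⊆ U)
    (h2 : ¬ (U : Set _) ⊆ S2 Ω) (h4 : ∀ μ, ℵ₀ ≤ μ → μ ≤ #Ω → ¬ (U : Set _) ⊆ S4 Ω μ) :
    ∃ i : Ω → Ω, i ∈ U ∧ Function.Injective i ∧ defect i = #Ω := by
  have key : ∀ (c : Cardinal.{u}) (u : Ω → Ω), collapse u = c → u ∈ U → collapse u < #Ω →
      #Ω ≤ defect u → ∃ i : Ω → Ω, i ∈ U ∧ Function.Injective i ∧ defect i = #Ω := by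
    intro c
    induction c using WellFoundedLT.induction with
    | ind c ih =>
      rintro u rfl hu hc hd
      by_cases h0 : collapse u = 0
      · exact ⟨u, hu, collapse_eq_zero_iff.1 h0, le_antisymm (defect_le_mk u) hd⟩
      · obtain ⟨v, hv, hvc, hvd⟩ := exists_mem_collapse_lt hU h2 h4 hu hc h0
        exact ih _ hvc v rfl hv (hvc.trans hc) (hd.trans hvd)
  obtain ⟨u, hu, huS⟩ := Set.not_subset.1 (h4 _ (aleph0_le_mk Ω) le_rfl)
  have huS : ¬ (_ ∨ _) := huS
  rw [not_or, not_le, not_lt] at huS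
  exact key _ u rfl hu huS.1 huS.2

theorem exists_mem_surjective_collapse_eq [Infinite Ω] (hU : symSet Ω ⊆ U)
    (h1 : ¬ (U : Set _) ⊆ S1 Ω) (h3 : ∀ μ, ℵ₀ ≤ μ → μ ≤ #Ω → ¬ (U : Set _) ⊆ S3 Ω μ) :
    ∃ s : Ω → Ω, s ∈ U ∧ Function.Surjective s ∧ collapse s = #Ω := by
  have key : ∀ (d : Cardinal.{u}) (u : Ω → Ω), defect u = d → u ∈ U → defect u < #Ω →
      #Ω ≤ collapse u → ∃ s : Ω → Ω, s ∈ U ∧ Function.Surjective s ∧ collapse s = #Ω := by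
    intro d
    induction d using WellFoundedLT.induction with
    | ind d ih =>
      rintro u rfl hu hd hc
      by_cases h0 : defect u = 0
      · exact ⟨u, hu, defect_eq_zero_iff.1 h0, le_antisymm (collapse_le_mk u) hc⟩
      · obtain ⟨v, hv, hvd, hvc⟩ := exists_mem_defect_lt hU h1 h3 hu hd h0
        exact ih _ hvd v rfl hv (hvd.trans hd) (hc.trans hvc)
  obtain ⟨u, hu, huS⟩ := Set.not_subset.1 (h3 _ (aleph0_le_mk Ω) le_rfl)
  have huS : ¬ (_ ∨ _) := huS
  rw [not_or, not_lt, not_le] at huS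
  exact key _ u rfl hu huS.2 huS.1

/-- A section of `s` has a transversal as range, whose complement has size `#Ω`. So some `π` carries
points `k α` with full fibres under `f` to the values of the section, and the fibre of `s ∘ π ∘ f`
over `α` contains that of `f` over `k α`. -/
theorem exists_mem_forall_mk_preimage [Infinite Ω] (hU : symSet Ω ⊆ U) {s f : Ω → Ω} (hs : s ∈ U)
    (hss : Function.Surjective s) (hsc : collapse s = #Ω) (hf : f ∈ U)
    (hfk : #Ω ≤ contraction f #Ω) :
    ∃ w : Ω → Ω, w ∈ U ∧ ∀ α, #Ω ≤ #(w ⁻¹' {α} : Set Ω) := by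
  obtain ⟨k, hk, hkf, hkc⟩ := exists_injective_forall_mem_mk_compl (X := Ω) rfl
    (fun _ => {α : Ω | #Ω ≤ #(f ⁻¹' {α} : Set Ω)}) fun _ => hfk
  have hright := Function.rightInverse_surjInv hss
  have ht : IsTransversal s (Set.range (Function.surjInv hss)) := by
    constructor
    · rintro _ ⟨x, rfl⟩ _ ⟨y, rfl⟩ h
      rw [hright x, hright y] at h
      rw [h]
    · rw [← Set.range_comp, hright.comp_eq_id, Set.range_id, hss.range_eq]
  obtain ⟨π, hπ⟩ := exists_perm_extending hk hright.injective
    (by rw [hkc, ht.mk_compl, hsc])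
  refine ⟨_, comp_perm_comp_mem hU hs hf π, fun α => (hkf α).trans (mk_le_mk_of_subset ?_)⟩
  intro x hx
  have hx : f x = k α := hx
  simp [hx, hπ, hright α]

theorem eq_top_of_injective_of_mk_preimage [Infinite Ω] (hU : symSet Ω ⊆ U) {i w : Ω → Ω}
    (hi : i ∈ U) (hii : Function.Injective i) (hid : defect i = #Ω) (hw : w ∈ U)
    (hwk : ∀ α, #Ω ≤ #(w ⁻¹' {α} : Set Ω)) : U = ⊤ := by
  refine eq_top_iff.2 fun g _ => ?_
  obtain ⟨j, hj, hjw, hjc⟩ := exists_injective_forall_mem_mk_compl (X := Ω) rfl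
    (fun x => w ⁻¹' {g x}) fun x => hwk (g x)
  obtain ⟨π, hπ⟩ := exists_perm_extending hii hj (hid.trans hjc.symm)
  have he : w ∘ π ∘ i = g := by
    funext x
    exact (congrArg w (hπ x)).trans (hjw x)
  rw [← he]
  exact comp_perm_comp_mem hU hw hi π

/-- The proper initial segments below the members of a cofinal set of least size cover a well-order
of type `κ.ord`; singularity makes the cofinal set smaller than `κ`. -/
theorem exists_family_lt_le_sum {κ : Cardinal.{u}} (hκ : κ.IsSingular) :
    ∃ (ι : Type u) (c : ι → Cardinal.{u}), #ι < κ ∧ (∀ i, c i < κ) ∧ κ ≤ Cardinal.sum c := by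
  have := noMaxOrder hκ.aleph0_le
  obtain ⟨S, hS, hSc⟩ := Order.exists_cof_eq κ.ord.ToType
  refine ⟨S, fun s => #(Set.Iio (s : κ.ord.ToType)), ?_,
    fun s => (mk_Iio_lt _ (by simp)).trans_eq (mk_ord_toType κ), ?_⟩
  · rw [hSc, Ordinal.cof_toType]
    exact hκ.cof_ord_lt
  · refine le_trans ?_ (mk_iUnion_le_sum_mk (f := fun s : S => Set.Iio (s : κ.ord.ToType)))
    refine (mk_ord_toType κ).ge.trans (mk_univ.ge.trans ?_)
    refine mk_le_mk_of_subset fun x _ => ?_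
    obtain ⟨y, hy⟩ := exists_gt x
    obtain ⟨z, hz, hyz⟩ := hS y
    exact Set.mem_iUnion.2 ⟨⟨z, hz⟩, hy.trans_le hyz⟩

/-- Full fibres are assembled in two layers. In `f ∘ π ∘ f` the outer `f` merges `ι` points over `k
x`, and `π` puts on the `i`-th of them a point `b (x, i)` whose fibre under the inner `f` has size
at least `c i`. The sizes add up to at least `#Ω`. -/
theorem exists_mem_contraction_of_isSingular [Infinite Ω] (hΩ : (#Ω).IsSingular)
    (hU : symSet Ω ⊆ U) {f : Ω → Ω} (hf : f ∈ U) (hfk : ∀ ν < #Ω, #Ω ≤ contraction f ν) :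
    ∃ g : Ω → Ω, g ∈ U ∧ #Ω ≤ contraction g #Ω := by
  obtain ⟨ι, c, hι, hc, hsum⟩ := exists_family_lt_le_sum hΩ
  have hΩω := aleph0_le_mk Ω
  have hne : Nonempty ι := by
    by_contra h
    rw [not_nonempty_iff] at h
    have := hsum.trans (sum_le_mk_mul_iSup c)
    simp at this
  obtain ⟨i₀⟩ := id hne
  have hX : #(Ω × ι) = #Ω := by
    rw [← mul_def]
    exact mul_eq_left hΩω hι.le (mk_ne_zero ι)
  obtain ⟨b, hb, hbf, hbc⟩ := exists_injective_forall_mem_mk_compl hX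
    (fun x => {β : Ω | c x.2 ≤ #(f ⁻¹' {β} : Set Ω)}) fun x => hfk _ (hc x.2)
  -- The right-hand copy of `Ω` only supplies unused points, so that the complement of the targets
  -- of `π` has size `#Ω`.
  obtain ⟨k, hk, hkf⟩ := exists_injective_forall_mem (X := Ω ⊕ Ω)
    (fun _ => {α : Ω | #ι ≤ #(f ⁻¹' {α} : Set Ω)}) (fun _ => by
      rw [← add_def, add_eq_self hΩω]
      exact hfk _ hι)
  have he : ∀ x, Nonempty (ι ↪ (f ⁻¹' {k x} : Set Ω)) := fun x => hkf x
  have e := fun x => (he x).some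
  have hfe : ∀ x i, f (e x i) = k x := fun x i => (e x i).2
  have hke : ∀ x y i j, (e x i : Ω) = e y j → x = y := fun x y i j h =>
    hk ((hfe x i).symm.trans ((congrArg f h).trans (hfe y j)))
  have ha : Function.Injective fun x : Ω × ι => (e (Sum.inl x.1) x.2 : Ω) := by
    rintro ⟨x, i⟩ ⟨y, j⟩ hxy
    have hxy : (e (Sum.inl x) i : Ω) = e (Sum.inl y) j := hxy
    obtain rfl := Sum.inl_injective (hke _ _ _ _ hxy)
    rw [(e _).injective (Subtype.ext hxy)]
  have hac : #((Set.range fun x : Ω × ι => (e (Sum.inl x.1) x.2 : Ω))ᶜ : Set Ω) = #Ω := by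
    have hinj : Function.Injective fun x : Ω => (e (Sum.inr x) i₀ : Ω) := by
      intro x y hxy
      exact Sum.inr_injective (hke _ _ _ _ hxy)
    refine le_antisymm (mk_set_le _) ((mk_range_eq _ hinj).ge.trans (mk_le_mk_of_subset ?_))
    rintro _ ⟨x, rfl⟩ ⟨⟨y, i⟩, hy⟩
    exact Sum.inl_ne_inr (hke _ _ _ _ hy)
  obtain ⟨π, hπ⟩ := exists_perm_extending hb ha (hbc.trans hac.symm)
  refine ⟨_, comp_perm_comp_mem hU hf hf π, ?_⟩
  refine (mk_range_eq _ (hk.comp Sum.inl_injective)).ge.trans (mk_le_mk_of_subset ?_)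
  rintro _ ⟨x, rfl⟩
  change #Ω ≤ #((f ∘ π ∘ f) ⁻¹' {k (Sum.inl x)} : Set Ω)
  refine hsum.trans ((sum_le_sum _ _ fun i => hbf (x, i)).trans ?_)
  rw [← mk_sigma]
  refine mk_le_of_injective (f := fun y => ⟨y.2.1, ?_⟩) ?_
  · have hy : f y.2.1 = b (x, y.1) := y.2.2
    simp [hy, hπ, hfe]
  · rintro ⟨i, y, hy⟩ ⟨j, z, hz⟩ hyz
    obtain rfl : y = z := congrArg Subtype.val hyz
    have hy' : f y = b (x, i) := hy
    have hz' : f y = b (x, j) := hz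
    obtain rfl : i = j := congrArg Prod.snd (hb (hy'.symm.trans hz'))
    rfl

end Generation

/-! ### Maps that separate the listed sets. -/

theorem exists_collapse_eq_defect_eq [Infinite Ω] {c d : Cardinal.{u}} (hc : c ≤ #Ω)
    (hd : d ≤ #Ω) :
    ∃ f : Ω → Ω, collapse f = c ∧ defect f = d ∧ ∀ α, #(f ⁻¹' {α} : Set Ω) ≤ 2 := by
  have hΩ := aleph0_le_mk Ω
  have hsum : ∀ a ≤ #Ω, Nonempty (Ω ≃ Ω ⊕ a.out) := fun a ha => by
    rw [← Cardinal.eq, ← add_def, mk_out, add_eq_left hΩ ha]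
  obtain ⟨e⟩ := hsum c hc
  obtain ⟨e'⟩ := hsum d hd
  obtain ⟨k⟩ : Nonempty (c.out ↪ Ω) := by rwa [← Cardinal.le_def, mk_out]
  -- Folding `c` extra points injectively into `Ω` gives collapse `c`; embedding the result as the
  -- left summand of `Ω ⊕ d.out` gives defect `d`. A fibre has at most one point from each summand
  -- of the source.
  let f : Ω → Ω := fun x => e'.symm (Sum.inl (Sum.elim id k (e x)))
  have hf : ∀ x, f (e.symm (Sum.inl x)) = e'.symm (Sum.inl x) := fun x => by simp [f]
  have hrange : Set.range f = Set.range (e'.symm ∘ Sum.inl) := by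
    ext y
    constructor
    · rintro ⟨x, rfl⟩
      exact ⟨_, rfl⟩
    · rintro ⟨x, rfl⟩
      exact ⟨_, hf x⟩
  have hcompl : ∀ {A : Type u} (e : Ω ≃ Ω ⊕ A),
      #((Set.range (e.symm ∘ Sum.inl))ᶜ : Set Ω) = #A := fun {A} e => by
    rw [Set.range_comp, ← Set.image_compl_eq e.symm.bijective, Set.compl_range_inl,
      mk_image_eq e.symm.injective, mk_range_eq _ Sum.inr_injective]
  refine ⟨f, ?_, ?_, fun α => ?_⟩
  · have hT : IsTransversal f (Set.range (e.symm ∘ Sum.inl)) := by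
      constructor
      · rintro _ ⟨x, rfl⟩ _ ⟨y, rfl⟩ h
        have h : f (e.symm (Sum.inl x)) = f (e.symm (Sum.inl y)) := h
        rw [hf, hf] at h
        rw [Sum.inl_injective (e'.symm.injective h)]
      · rw [hrange, ← Set.range_comp]
        exact congrArg Set.range (funext hf)
    rw [← hT.mk_compl, hcompl, mk_out]
  · rw [defect, hrange, hcompl, mk_out]
  · have h2 : #(ULift.{u} Bool) = 2 := by simp
    rw [← h2]
    refine mk_le_of_injective (f := fun x => ULift.up (e x).isLeft) ?_
    rintro ⟨x, hx⟩ ⟨y, hy⟩ hxy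
    have hxy : (e x).isLeft = (e y).isLeft := ULift.up_injective hxy
    have h : Sum.elim id k (e x) = Sum.elim id k (e y) :=
      Sum.inl_injective (e'.symm.injective ((hx : f x = α).trans (hy : f y = α).symm))
    refine Subtype.ext (e.injective ?_)
    rcases hex : e x with a | a <;> rcases hey : e y with b | b <;> simp_all

theorem collapse_eq_of_mk_preimage [Infinite Ω] {f : Ω → Ω} {α : Ω}
    (h : #Ω ≤ #(f ⁻¹' {α} : Set Ω)) : collapse f = #Ω := by
  obtain ⟨Γ, hΓ, hc⟩ := exists_isTransversal_mk_compl f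
  refine le_antisymm (collapse_le_mk f) (not_lt.1 fun hlt => ?_)
  have hsub : f ⁻¹' {α} ⊆ Γᶜ ∪ (Γ ∩ f ⁻¹' {α}) := fun x hx => by
    by_cases hxΓ : x ∈ Γ
    · exact Or.inr ⟨hxΓ, hx⟩
    · exact Or.inl hxΓ
  have hone : #(Γ ∩ f ⁻¹' {α} : Set Ω) ≤ 1 := by
    rw [le_one_iff_subsingleton]
    refine ⟨fun x y => Subtype.ext (hΓ.1 x.2.1 y.2.1 ?_)⟩
    exact (x.2.2 : f x = α).trans (y.2.2 : f y = α).symm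
  refine absurd (h.trans ((mk_le_mk_of_subset hsub).trans (mk_union_le _ _))) (not_le.2 ?_)
  have hΩ := aleph0_le_mk Ω
  exact add_lt_of_lt hΩ (hc ▸ hlt) (hone.trans_lt (one_lt_aleph0.trans_le hΩ))

/-- A projection `Ω × Ω → Ω` followed by an injection of full defect. With full collapse and defect
it lies in every set of the list except the contraction one. -/
theorem exists_contraction_eq [Infinite Ω] :
    ∃ f : Ω → Ω, collapse f = #Ω ∧ defect f = #Ω ∧ contraction f #Ω = #Ω := by
  have hΩ := aleph0_le_mk Ω
  obtain ⟨i, hic, hid, -⟩ := exists_collapse_eq_defect_eq (Ω := Ω) zero_le le_rfl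
  obtain ⟨p⟩ : Nonempty (Ω ≃ Ω × Ω) := by
    rw [← Cardinal.eq, ← mul_def, mul_eq_self hΩ]
  have hfib : ∀ x, #Ω ≤ #((i ∘ fun y => (p y).1) ⁻¹' {i x} : Set Ω) := fun x =>
    mk_le_of_injective (f := fun y => ⟨p.symm (x, y), by simp⟩) fun y z h => by
      simpa using congrArg Subtype.val h
  obtain ⟨x₀⟩ : Nonempty Ω := inferInstance
  refine ⟨i ∘ fun y => (p y).1, collapse_eq_of_mk_preimage (hfib x₀),
    le_antisymm (defect_le_mk _) (hid.ge.trans (defect_le_defect_comp _ _)),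
    le_antisymm (contraction_le_mk _ _) ?_⟩
  refine (mk_range_eq _ (collapse_eq_zero_iff.1 hic)).ge.trans (mk_le_mk_of_subset ?_)
  rintro _ ⟨x, rfl⟩
  exact hfib x

theorem exists_mem_notMem_S1 [Infinite Ω] :
    ∃ f : Ω → Ω, (∀ α, #(f ⁻¹' {α} : Set Ω) ≤ 2) ∧ f ∉ S1 Ω ∧ f ∈ S2 Ω ∧
      ∀ μ, ℵ₀ ≤ μ → f ∈ S3 Ω μ ∧ f ∈ S4 Ω μ := by
  obtain ⟨f, hc, hd, h2⟩ := exists_collapse_eq_defect_eq (Ω := Ω)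
    (one_le_aleph0.trans (aleph0_le_mk Ω)) zero_le
  refine ⟨f, h2, ?_, Or.inl (hc ▸ one_pos), fun μ hμ =>
    ⟨Or.inl (hc ▸ one_lt_aleph0.trans_le hμ), Or.inr (hd ▸ aleph0_pos.trans_le hμ)⟩⟩
  rintro (h | h)
  · exact one_ne_zero (hc.symm.trans h)
  · exact h.ne' hd

theorem exists_mem_notMem_S2 [Infinite Ω] :
    ∃ f : Ω → Ω, (∀ α, #(f ⁻¹' {α} : Set Ω) ≤ 2) ∧ f ∉ S2 Ω ∧ f ∈ S1 Ω ∧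
      ∀ μ, ℵ₀ ≤ μ → f ∈ S3 Ω μ ∧ f ∈ S4 Ω μ := by
  obtain ⟨f, hc, hd, h2⟩ := exists_collapse_eq_defect_eq (Ω := Ω) zero_le
    (one_le_aleph0.trans (aleph0_le_mk Ω))
  refine ⟨f, h2, ?_, Or.inl hc, fun μ hμ =>
    ⟨Or.inl (hc ▸ aleph0_pos.trans_le hμ), Or.inr (hd ▸ one_lt_aleph0.trans_le hμ)⟩⟩
  rintro (h | h)
  · exact h.ne' hc
  · exact one_ne_zero (hd.symm.trans h)

/-- Collapse `μ` with defect `ν` works when `ν < μ`, and with defect `1` when `μ < ν`. The positive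
defect and collapse keep the map in `S1` and `S2`. -/
theorem exists_mem_notMem_S3 [Infinite Ω] {μ ν : Cardinal.{u}} (hμ : ℵ₀ ≤ μ) (hμ' : μ ≤ #Ω)
    (hν : ℵ₀ ≤ ν) (hνμ : ν ≠ μ) :
    ∃ f : Ω → Ω, (∀ α, #(f ⁻¹' {α} : Set Ω) ≤ 2) ∧ f ∉ S3 Ω μ ∧ f ∈ S1 Ω ∧ f ∈ S2 Ω ∧
      f ∈ S3 Ω ν := by
  rcases hνμ.lt_or_gt with h | h
  · obtain ⟨f, hc, hd, h2⟩ := exists_collapse_eq_defect_eq (Ω := Ω) hμ' (h.le.trans hμ')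
    refine ⟨f, h2, ?_, Or.inr (hd ▸ aleph0_pos.trans_le hν),
      Or.inl (hc ▸ aleph0_pos.trans_le hμ), Or.inr hd.ge⟩
    rintro (h' | h')
    · exact h'.ne hc
    · exact h.not_ge (hd ▸ h')
  · obtain ⟨f, hc, hd, h2⟩ := exists_collapse_eq_defect_eq (Ω := Ω) hμ'
      (one_le_aleph0.trans (aleph0_le_mk Ω))
    refine ⟨f, h2, ?_, Or.inr (hd ▸ one_pos),
      Or.inl (hc ▸ aleph0_pos.trans_le hμ), Or.inl (hc ▸ h)⟩
    rintro (h' | h')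
    · exact h'.ne hc
    · exact (one_lt_aleph0.trans_le hμ).not_ge (hd ▸ h')

theorem exists_mem_S4_notMem_S3 [Infinite Ω] {μ : Cardinal.{u}} (hμ : ℵ₀ ≤ μ) (hμ' : μ ≤ #Ω) :
    ∃ f : Ω → Ω, (∀ α, #(f ⁻¹' {α} : Set Ω) ≤ 2) ∧ f ∉ S3 Ω μ ∧ f ∈ S1 Ω ∧ f ∈ S2 Ω ∧
      ∀ ν, ℵ₀ ≤ ν → f ∈ S4 Ω ν := by
  obtain ⟨f, hc, hd, h2⟩ := exists_collapse_eq_defect_eq (Ω := Ω) hμ'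
    (one_le_aleph0.trans (aleph0_le_mk Ω))
  refine ⟨f, h2, ?_, Or.inr (hd ▸ one_pos), Or.inl (hc ▸ aleph0_pos.trans_le hμ),
    fun ν hν => Or.inr (hd ▸ one_lt_aleph0.trans_le hν)⟩
  rintro (h' | h')
  · exact h'.ne hc
  · exact (one_lt_aleph0.trans_le hμ).not_ge (hd ▸ h')

theorem exists_mem_notMem_S4 [Infinite Ω] {μ ν : Cardinal.{u}} (hμ : ℵ₀ ≤ μ) (hμ' : μ ≤ #Ω)
    (hν : ℵ₀ ≤ ν) (hνμ : ν ≠ μ) :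
    ∃ f : Ω → Ω, (∀ α, #(f ⁻¹' {α} : Set Ω) ≤ 2) ∧ f ∉ S4 Ω μ ∧ f ∈ S1 Ω ∧ f ∈ S2 Ω ∧
      f ∈ S4 Ω ν := by
  rcases hνμ.lt_or_gt with h | h
  · obtain ⟨f, hc, hd, h2⟩ := exists_collapse_eq_defect_eq (Ω := Ω) (h.le.trans hμ') hμ'
    refine ⟨f, h2, ?_, Or.inr (hd ▸ aleph0_pos.trans_le hμ),
      Or.inl (hc ▸ aleph0_pos.trans_le hν), Or.inl hc.ge⟩
    rintro (h' | h')
    · exact h.not_ge (hc ▸ h')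
    · exact h'.ne hd
  · obtain ⟨f, hc, hd, h2⟩ := exists_collapse_eq_defect_eq (Ω := Ω)
      (one_le_aleph0.trans (aleph0_le_mk Ω)) hμ'
    refine ⟨f, h2, ?_, Or.inr (hd ▸ aleph0_pos.trans_le hμ),
      Or.inl (hc ▸ one_pos), Or.inr (hd ▸ h)⟩
    rintro (h' | h')
    · exact (one_lt_aleph0.trans_le hμ).not_ge (hc ▸ h')
    · exact h'.ne hd

theorem exists_mem_S3_notMem_S4 [Infinite Ω] {μ : Cardinal.{u}} (hμ : ℵ₀ ≤ μ) (hμ' : μ ≤ #Ω) :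
    ∃ f : Ω → Ω, (∀ α, #(f ⁻¹' {α} : Set Ω) ≤ 2) ∧ f ∉ S4 Ω μ ∧ f ∈ S1 Ω ∧ f ∈ S2 Ω ∧
      ∀ ν, ℵ₀ ≤ ν → f ∈ S3 Ω ν := by
  obtain ⟨f, hc, hd, h2⟩ := exists_collapse_eq_defect_eq (Ω := Ω)
    (one_le_aleph0.trans (aleph0_le_mk Ω)) hμ'
  refine ⟨f, h2, ?_, Or.inr (hd ▸ aleph0_pos.trans_le hμ), Or.inl (hc ▸ one_pos),
    fun ν hν => Or.inl (hc ▸ one_lt_aleph0.trans_le hν)⟩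
  rintro (h' | h')
  · exact (one_lt_aleph0.trans_le hμ).not_ge (hc ▸ h')
  · exact h'.ne hd

/-! ### Assembling the classification. -/

theorem symSet_subset_S1 : symSet Ω ⊆ S1 Ω := fun _ hf => mem_S1_iff.2 (Or.inl hf.1)

theorem symSet_subset_S2 : symSet Ω ⊆ S2 Ω := fun _ hf => mem_S2_iff.2 (Or.inr hf.2)

theorem symSet_subset_S3 {μ : Cardinal.{u}} (hμ : ℵ₀ ≤ μ) : symSet Ω ⊆ S3 Ω μ := fun _ hf =>
  Or.inl ((collapse_eq_zero_iff.2 hf.1).trans_lt (aleph0_pos.trans_le hμ))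

theorem symSet_subset_S4 {μ : Cardinal.{u}} (hμ : ℵ₀ ≤ μ) : symSet Ω ⊆ S4 Ω μ := fun _ hf =>
  Or.inr ((defect_eq_zero_iff.2 hf.2).trans_lt (aleph0_pos.trans_le hμ))

/-- The classification of the maximal subsemigroups containing the symmetric group, with the
properties of `S₅` or `S₅′` that it depends on as hypotheses on the set `X`. -/
theorem isMaximalSubsemigroup_iff_of_contraction [Infinite Ω] {X : Set (Function.End Ω)}
    (hmul : ∀ f ∈ X, ∀ g ∈ X, f * g ∈ X)
    (hsmall : ∀ f : Ω → Ω, (∀ α, #(f ⁻¹' {α} : Set Ω) ≤ 2) → f ∈ X)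
    (hbig : ∀ f : Ω → Ω, contraction f #Ω = #Ω → f ∉ X)
    (hgen : ∀ U : Subsemigroup (Function.End Ω), symSet Ω ⊆ U → ¬ (U : Set _) ⊆ X →
      ∃ f : Ω → Ω, f ∈ U ∧ #Ω ≤ contraction f #Ω)
    (T : Set (Function.End Ω)) : (IsMaximalSubsemigroup T ∧ symSet Ω ⊆ T) ↔
      T = S1 Ω ∨ T = S2 Ω ∨
      (∃ μ, ℵ₀ ≤ μ ∧ μ ≤ #Ω ∧ (T = S3 Ω μ ∨ T = S4 Ω μ)) ∨ T = X := by
  have hanti : ∀ L, (L = S1 Ω ∨ L = S2 Ω ∨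
      (∃ μ, ℵ₀ ≤ μ ∧ μ ≤ #Ω ∧ (L = S3 Ω μ ∨ L = S4 Ω μ)) ∨ L = X) → ∀ L', (L' = S1 Ω ∨
      L' = S2 Ω ∨ (∃ μ, ℵ₀ ≤ μ ∧ μ ≤ #Ω ∧ (L' = S3 Ω μ ∨ L' = S4 Ω μ)) ∨ L' = X) →
      L ⊆ L' → L = L' := by
    -- For each target one map outside it lies in all the other sets, except that comparing two sets
    -- `S3`, or two sets `S4`, needs a map depending on both cardinals.
    rintro L hL _ (rfl | rfl | ⟨μ, hμ, hμ', rfl | rfl⟩ | rfl) hsub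
    · obtain ⟨f, hf, hn, h, h34⟩ := exists_mem_notMem_S1 (Ω := Ω)
      rcases hL with rfl | rfl | ⟨ν, hν, -, rfl | rfl⟩ | rfl
      · rfl
      · exact absurd (hsub h) hn
      · exact absurd (hsub (h34 ν hν).1) hn
      · exact absurd (hsub (h34 ν hν).2) hn
      · exact absurd (hsub (hsmall f hf)) hn
    · obtain ⟨f, hf, hn, h, h34⟩ := exists_mem_notMem_S2 (Ω := Ω)
      rcases hL with rfl | rfl | ⟨ν, hν, -, rfl | rfl⟩ | rfl
      · exact absurd (hsub h) hn
      · rfl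
      · exact absurd (hsub (h34 ν hν).1) hn
      · exact absurd (hsub (h34 ν hν).2) hn
      · exact absurd (hsub (hsmall f hf)) hn
    · obtain ⟨f, hf, hn, h1, h2, h4⟩ := exists_mem_S4_notMem_S3 (Ω := Ω) hμ hμ'
      rcases hL with rfl | rfl | ⟨ν, hν, -, rfl | rfl⟩ | rfl
      · exact absurd (hsub h1) hn
      · exact absurd (hsub h2) hn
      · by_contra hne
        obtain ⟨g, -, hgn, -, -, hg⟩ := exists_mem_notMem_S3 (Ω := Ω) hμ hμ' hν
          (fun h => hne (congrArg (S3 Ω) h))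
        exact hgn (hsub hg)
      · exact absurd (hsub (h4 ν hν)) hn
      · exact absurd (hsub (hsmall f hf)) hn
    · obtain ⟨f, hf, hn, h1, h2, h3⟩ := exists_mem_S3_notMem_S4 (Ω := Ω) hμ hμ'
      rcases hL with rfl | rfl | ⟨ν, hν, -, rfl | rfl⟩ | rfl
      · exact absurd (hsub h1) hn
      · exact absurd (hsub h2) hn
      · exact absurd (hsub (h3 ν hν)) hn
      · by_contra hne
        obtain ⟨g, -, hgn, -, -, hg⟩ := exists_mem_notMem_S4 (Ω := Ω) hμ hμ' hν
          (fun h => hne (congrArg (S4 Ω) h))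
        exact hgn (hsub hg)
      · exact absurd (hsub (hsmall f hf)) hn
    · obtain ⟨f, hc, hd, hk⟩ := exists_contraction_eq (Ω := Ω)
      have hn := hbig f hk
      have hpos : 0 < #Ω := aleph0_pos.trans_le (aleph0_le_mk Ω)
      rcases hL with rfl | rfl | ⟨ν, hν, hν', rfl | rfl⟩ | rfl
      · exact absurd (hsub (Or.inr (hd ▸ hpos) : f ∈ S1 Ω)) hn
      · exact absurd (hsub (Or.inl (hc ▸ hpos) : f ∈ S2 Ω)) hn
      · exact absurd (hsub (Or.inr (hd ▸ hν') : f ∈ S3 Ω ν)) hn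
      · exact absurd (hsub (Or.inl (hc ▸ hν') : f ∈ S4 Ω ν)) hn
      · rfl
  refine isMaximalSubsemigroup_iff_mem (𝓛 := {T | T = S1 Ω ∨ T = S2 Ω ∨
    (∃ μ, ℵ₀ ≤ μ ∧ μ ≤ #Ω ∧ (T = S3 Ω μ ∨ T = S4 Ω μ)) ∨ T = X}) ?_ ?_ ?_ hanti ?_ T
  · rintro _ (rfl | rfl | ⟨μ, hμ, -, rfl | rfl⟩ | rfl) f hf g hg
    · exact S1.mul_mem hf hg
    · exact S2.mul_mem hf hg
    · exact S3.mul_mem hμ hf hg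
    · exact S4.mul_mem hμ hf hg
    · exact hmul f hf g hg
  · rintro _ (rfl | rfl | ⟨μ, hμ, -, rfl | rfl⟩ | rfl)
    · exact symSet_subset_S1
    · exact symSet_subset_S2
    · exact symSet_subset_S3 hμ
    · exact symSet_subset_S4 hμ
    · refine fun f hf => hsmall f fun α => (?_ : _ ≤ (1 : Cardinal)).trans one_le_two
      rw [le_one_iff_subsingleton]
      exact ⟨fun x y => Subtype.ext (hf.1 ((x.2 : f x = α).trans (y.2 : f y = α).symm))⟩
  · rintro L hL rfl
    -- If the whole semigroup were listed, the antichain property would make both `S1` and `S2`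
    -- equal to it.
    have h1 := hanti _ (Or.inl rfl) _ hL (Set.subset_univ _)
    have h2 := hanti _ (Or.inr (Or.inl rfl)) _ hL (Set.subset_univ _)
    obtain ⟨f, -, hn, h, -⟩ := exists_mem_notMem_S1 (Ω := Ω)
    exact hn (h1 ▸ h2 ▸ h)
  · intro U hU hcover
    have h3 : ∀ μ, ℵ₀ ≤ μ → μ ≤ #Ω → ¬ (U : Set _) ⊆ S3 Ω μ := fun μ hμ hμ' =>
      hcover _ (Or.inr (Or.inr (Or.inl ⟨μ, hμ, hμ', Or.inl rfl⟩)))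
    have h4 : ∀ μ, ℵ₀ ≤ μ → μ ≤ #Ω → ¬ (U : Set _) ⊆ S4 Ω μ := fun μ hμ hμ' =>
      hcover _ (Or.inr (Or.inr (Or.inl ⟨μ, hμ, hμ', Or.inr rfl⟩)))
    obtain ⟨i, hi, hii, hid⟩ :=
      exists_mem_injective_defect_eq hU (hcover _ (Or.inr (Or.inl rfl))) h4
    obtain ⟨s, hs, hss, hsc⟩ := exists_mem_surjective_collapse_eq hU (hcover _ (Or.inl rfl)) h3
    obtain ⟨f, hf, hfk⟩ := hgen U hU (hcover _ (Or.inr (Or.inr (Or.inr rfl))))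
    obtain ⟨w, hw, hwk⟩ := exists_mem_forall_mk_preimage hU hs hss hsc hf hfk
    exact eq_top_of_injective_of_mk_preimage hU hi hii hid hw hwk

theorem contraction_eq_zero {f : Ω → Ω} {μ ν : Cardinal.{u}}
    (h : ∀ α, #(f ⁻¹' {α} : Set Ω) ≤ μ) (hμν : μ < ν) : contraction f ν = 0 := by
  rw [contraction, mk_set_eq_zero_iff, Set.eq_empty_iff_forall_notMem]
  exact fun α hα => (hμν.trans_le hα).not_ge (h α)

end FullTransformation

open FullTransformation

theorem theoremA {Ω : Type*} [Infinite Ω] :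
    ((#Ω).IsRegular →
      ∀ T : Set (Function.End Ω), (IsMaximalSubsemigroup T ∧ symSet Ω ⊆ T) ↔
        T = S1 Ω ∨ T = S2 Ω ∨
        (∃ μ, ℵ₀ ≤ μ ∧ μ ≤ #Ω ∧ (T = S3 Ω μ ∨ T = S4 Ω μ)) ∨
        T = S5 Ω) ∧
    ((#Ω).IsSingular →
      ∀ T : Set (Function.End Ω), (IsMaximalSubsemigroup T ∧ symSet Ω ⊆ T) ↔
        T = S1 Ω ∨ T = S2 Ω ∨
        (∃ μ, ℵ₀ ≤ μ ∧ μ ≤ #Ω ∧ (T = S3 Ω μ ∨ T = S4 Ω μ)) ∨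
        T = S5' Ω) := by
  have hΩ := aleph0_le_mk Ω
  have hpos : 0 < #Ω := aleph0_pos.trans_le hΩ
  have hnat : ∀ n : ℕ, (n : Cardinal) < #Ω := fun n => natCast_lt_aleph0.trans_le hΩ
  constructor
  · refine fun hreg => isMaximalSubsemigroup_iff_of_contraction
      (fun f hf g hg => S5.mul_mem hreg hf hg)
      (fun f hf => ?_) (fun f hf hf' => (hf' : contraction f #Ω < #Ω).ne hf)
      fun U _ hU => ?_
    · exact (contraction_eq_zero hf (hnat 2)).trans_lt hpos
    · obtain ⟨f, hf, hfS⟩ := Set.not_subset.1 hU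
      exact ⟨f, hf, not_lt.1 hfS⟩
  · refine fun hsing => isMaximalSubsemigroup_iff_of_contraction
      (fun f hf g hg => S5'.mul_mem hsing hf hg)
      (fun f hf => ?_) ?_ fun U hsym hU => ?_
    -- Fibres have at most 2 points, so none reaches size 3.
    · exact ⟨(3 : ℕ), hnat 3, (contraction_eq_zero hf (by norm_num)).trans_lt hpos⟩
    · rintro f hf ⟨ν, hν, hfν⟩
      exact ((contraction_anti f hν.le).trans_lt hfν).ne hf
    · obtain ⟨f, hf, hfS⟩ := Set.not_subset.1 hU
      exact exists_mem_contraction_of_isSingular hsing hsym hf fun ν hν =>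
        not_lt.1 fun h => hfS ⟨ν, hν, h⟩
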